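/- Let $\mathring\Phi$ be a reduced irreducible finite (crystallographic) root system spanning a Euclidean space $V$, with short roots $\mathring\Phi_s$, long roots $\mathring\Phi_\ell$ (if there is only one root length, all roots are long) and lacing number $m$. Let $Y$ be a finite-dimensional real vector space and let $(\Lambda_\alpha)_{\alpha\in\mathring\Phi\cup\{0\}}$, $\Lambda_\alpha\subseteq Y$, be an extension datum of type $(\mathring\Phi,Y)$, i.e. $\Lambda_\beta-(\beta,\alpha^\vee)\Lambda_\alpha\subseteq\Lambda_{s_\alpha(\beta)}$ for all $\alpha,\beta\in\mathring\Phi$; $0\in\Lambda_\alpha$ for all $\alpha\in\mathring\Phi\cup\{0\}$; and the sets $\Lambda_\alpha$ together span $Y$. Then $\Lambda_\alpha$ depends only on the length of $\alpha\in\mathring\Phi$; write $\Lambda_s$ and $\Lambda_\ell$ for its value on short and long roots. Let $\Phi=\{\alpha\oplus y:\alpha\in\mathring\Phi,\ y\in\Lambda_\alpha\}\subseteq V\oplus Y$ be the set of real roots of the associated affine reflection system, with the form $(v_1\oplus y_1,v_2\oplus y_2)=(v_1,v_2)$ and the reflections $s_\alpha(x)=x-2\frac{(x,\alpha)}{(\alpha,\alpha)}\alpha$.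 A root subsystem of $\Phi$ (or of $\mathring\Phi$) is a non-empty subset $\Psi$ with $s_\alpha(\beta)\in\Psi$ for all $\alpha,\beta\in\Psi$; it is maximal if it is proper and not strictly contained in any other proper root subsystem. The lift of $\mathring\Psi\subseteq\mathring\Phi$ is $\widehat{\mathring\Psi}=\{\alpha\oplus y:\alpha\in\mathring\Psi,\ y\in\Lambda_\alpha\}$. (1) Assume that $\mathring\Phi$ is not of type $B_2$ or that $\Lambda_s$ is a subgroup of $Y$. If $\mathring\Phi_s$ is a maximal root subsystem of $\mathring\Phi$, then $\widehat{\mathring\Phi_s}$ is a maximal root subsystem of $\Phi$ if and only if $\Lambda_\ell=m\Lambda_s=\{my:y\in\Lambda_s\}$. (2) If $\mathring\Phi_\ell$ is a maximal root subsystem of $\mathring\Phi$, then $\widehat{\mathring\Phi_\ell}$ is a maximal root subsystem of $\Phi$ if and only if $\langle\Lambda_\ell\rangle=\Lambda_s$, where $\langle\Lambda_\ell\rangle$ is the subgroup of $Y$ generated by $\Lambda_\ell$. -/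

import Mathlib

open Set
open scoped Pointwise

noncomputable section

/-! ### Reflections, affine reflection systems and their root subsystems -/

/-- The reflection `s_α(x) = x - 2 (x, α) / (α, α) • α` of a symmetric bilinear form `B`; it is only
used for `(α, α) ≠ 0`. -/
def formReflection {X : Type*} [AddCommGroup X] [Module ℝ X]
    (B : LinearMap.BilinForm ℝ X) (α x : X) : X :=
  x - (2 * B x α / B α α) • α

/-- An affine reflection system `(X, Δ, (·,·))` in a finite-dimensional real vector space `X`. -/
structure AffineReflectionSystem (X : Type*) [AddCommGroup X] [Module ℝ X]
    [FiniteDimensional ℝ X] where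
  /-- the roots (real and imaginary) -/
  roots : Set X
  /-- the symmetric bilinear form -/
  form : LinearMap.BilinForm ℝ X
  form_symm : ∀ x y, form x y = form y x
  zero_mem : (0 : X) ∈ roots
  span_eq_top : Submodule.span ℝ roots = ⊤
  imaginary_mem_radical : ∀ α ∈ roots, form α α = 0 → ∀ x, form α x = 0
  reflection_image : ∀ α ∈ roots, form α α ≠ 0 → formReflection form α '' roots = roots
  integral : ∀ α ∈ roots, form α α ≠ 0 → ∀ β ∈ roots, ∃ n : ℤ, 2 * form β α / form α α = n
  finite : ∀ α ∈ roots, form α α ≠ 0 → ((fun β => 2 * form β α / form α α) '' roots).Finite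

/-- The set of real roots of an affine reflection system. -/
def AffineReflectionSystem.realRoots {X : Type*} [AddCommGroup X] [Module ℝ X]
    [FiniteDimensional ℝ X] (A : AffineReflectionSystem X) : Set X :=
  {α ∈ A.roots | A.form α α ≠ 0}

/-- `Ψ` is a root subsystem of the set `Φ` of (real) roots: a non-empty subset of `Φ` with
`s_α(β) ∈ Ψ` for all `α, β ∈ Ψ`. -/
def IsRootSubsystem {X : Type*} [AddCommGroup X] [Module ℝ X]
    (B : LinearMap.BilinForm ℝ X) (Φ Ψ : Set X) : Prop :=
  Ψ.Nonempty ∧ Ψ ⊆ Φ ∧ ∀ α ∈ Ψ, ∀ β ∈ Ψ, formReflection B α β ∈ Ψ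

/-- `Ψ` is a maximal root subsystem of `Φ`: it is maximal among the root subsystems of `Φ` that are
different from `Φ`. -/
def IsMaximalRootSubsystem {X : Type*} [AddCommGroup X] [Module ℝ X]
    (B : LinearMap.BilinForm ℝ X) (Φ Ψ : Set X) : Prop :=
  IsRootSubsystem B Φ Ψ ∧ Ψ ≠ Φ ∧
    ∀ Ψ' : Set X, IsRootSubsystem B Φ Ψ' → Ψ ⊆ Ψ' → Ψ' ≠ Φ → Ψ = Ψ'

/-! ### Finite root systems in a Euclidean space -/

section Finite

variable {ι V N : Type*} [NormedAddCommGroup V] [InnerProductSpace ℝ V]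
  [AddCommGroup N] [Module ℝ N]

/-- The coroots of `P` are given by the inner product of the Euclidean space `V`:
`(v, α^∨) = 2 (v, α) / (α, α)`. -/
def RootPairing.IsEuclidean (P : RootPairing ι ℝ V N) : Prop :=
  ∀ (i : ι) (v : V), P.coroot' i v = 2 * inner ℝ v (P.root i) / inner ℝ (P.root i) (P.root i)

/-- The (indices of the) roots of maximal length. When there is only one root length, all roots are
long. -/
def RootPairing.longRoots (P : RootPairing ι ℝ V N) : Set ι :=
  {i | ∀ j, ‖P.root j‖ ≤ ‖P.root i‖}

/-- The (indices of the) short roots of a reduced irreducible root system: the roots that are not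
long. -/
def RootPairing.shortRoots (P : RootPairing ι ℝ V N) : Set ι :=
  {i | ∃ j, ‖P.root i‖ < ‖P.root j‖}

/-- The lacing number `m` of an irreducible root system, as the ratio of the squared lengths of its
longest and its shortest roots: `1` for types `A`, `D`, `E`; `2` for types `B`, `C`, `F₄`; `3` for
type `G₂`. -/
def RootPairing.lacingNumber (P : RootPairing ι ℝ V N) : ℝ :=
  (⨆ i, ‖P.root i‖ ^ 2) / (⨅ i, ‖P.root i‖ ^ 2)

/-- The root system is of type `B₂`: it is `{±e, ±f, ±e ± f}` for two orthogonal non-zero vectors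
`e` and `f` of the same length. -/
def RootPairing.IsTypeB2 (P : RootPairing ι ℝ V N) : Prop :=
  ∃ e f : V, e ≠ 0 ∧ ‖e‖ = ‖f‖ ∧ inner ℝ e f = 0 ∧
    range P.root = {e, -e, f, -f, e + f, e - f, -e + f, -e - f}

/-- A root is divisible if its half is a root, too. -/
def RootPairing.IsDivisible (P : RootPairing ι ℝ V N) (i : ι) : Prop :=
  ∃ j, P.root i = (2 : ℝ) • P.root j

end Finite

/-! ### Extension data and the affine reflection systems constructed from them -/

/-- An extension datum `(Λ_α : α ∈ Φ ∪ {0})` of type `(Φ, Y)`, where `Φ` is the set of roots of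
`P`. -/
structure ExtensionDatum {ι V N : Type*} [NormedAddCommGroup V] [InnerProductSpace ℝ V]
    [AddCommGroup N] [Module ℝ N] (P : RootPairing ι ℝ V N)
    (Y : Type*) [AddCommGroup Y] [Module ℝ Y] where
  /-- the sets `Λ_α` for the roots `α` -/
  Λ : ι → Set Y
  /-- the set `Λ_0` -/
  Λzero : Set Y
  sub_smul_mem : ∀ i j, ∀ y ∈ Λ j, ∀ z ∈ Λ i, y - P.pairing j i • z ∈ Λ (P.reflectionPerm i j)
  zero_mem_zero : (0 : Y) ∈ Λzero
  zero_mem : ∀ i, ¬ P.IsDivisible i → (0 : Y) ∈ Λ i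
  nonempty : ∀ i, P.IsDivisible i → (Λ i).Nonempty
  span_eq_top : Submodule.span ℝ (Λzero ∪ ⋃ i, Λ i) = ⊤

namespace ExtensionDatum

variable {ι V N Y : Type*} [NormedAddCommGroup V] [InnerProductSpace ℝ V]
  [AddCommGroup N] [Module ℝ N] [AddCommGroup Y] [Module ℝ Y] {P : RootPairing ι ℝ V N}

/-- `Λ_s`: the common value of the `Λ_α` for the short roots `α`. -/
def Λs (E : ExtensionDatum P Y) : Set Y := ⋃ i ∈ P.shortRoots, E.Λ i

/-- `Λ_ℓ`: the common value of the `Λ_α` for the long roots `α`. -/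
def Λl (E : ExtensionDatum P Y) : Set Y := ⋃ i ∈ P.longRoots, E.Λ i

/-- The lift `{α ⊕ y : α ∈ S, y ∈ Λ_α} ⊆ V ⊕ Y` of a set `S` of roots. -/
def lift (E : ExtensionDatum P Y) (S : Set ι) : Set (V × Y) :=
  {x | ∃ i ∈ S, x.1 = P.root i ∧ x.2 ∈ E.Λ i}

/-- The roots `⋃ α ⊕ Λ_α`, `α ∈ Φ ∪ {0}`, of the affine reflection system constructed from an
extension datum. -/
def rootSet (E : ExtensionDatum P Y) : Set (V × Y) :=
  {x | x.1 = 0 ∧ x.2 ∈ E.Λzero} ∪ E.lift univ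

end ExtensionDatum

/-- The form `(v₁ ⊕ y₁, v₂ ⊕ y₂) = (v₁, v₂)` on `V ⊕ Y`. -/
def extendedForm (V Y : Type*) [NormedAddCommGroup V] [InnerProductSpace ℝ V]
    [AddCommGroup Y] [Module ℝ Y] : LinearMap.BilinForm ℝ (V × Y) :=
  (innerₗ V).compl₁₂ (LinearMap.fst ℝ V Y) (LinearMap.fst ℝ V Y)

theorem extendedForm_apply {V Y : Type*} [NormedAddCommGroup V] [InnerProductSpace ℝ V]
    [AddCommGroup Y] [Module ℝ Y] (x y : V × Y) :
    extendedForm V Y x y = inner ℝ x.1 y.1 := rfl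

theorem formReflection_formReflection {X : Type*} [AddCommGroup X] [Module ℝ X]
    (B : LinearMap.BilinForm ℝ X) (α x : X) (h : B α α ≠ 0) :
    formReflection B α (formReflection B α x) = x := by
  have : 2 * B (formReflection B α x) α / B α α = -(2 * B x α / B α α) := by
    simp only [formReflection, map_sub, map_smul, LinearMap.sub_apply, LinearMap.smul_apply,
      smul_eq_mul]
    field_simp
    ring
  rw [formReflection, this]
  simp [formReflection]

namespace ExtensionDatum

variable {ι V N Y : Type*} [NormedAddCommGroup V] [InnerProductSpace ℝ V]
  [AddCommGroup N] [Module ℝ N] [AddCommGroup Y] [Module ℝ Y] {P : RootPairing ι ℝ V N}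

theorem coeff_eq_pairing (hP : P.IsEuclidean) {i j : ι} {x y : V × Y}
    (hx : x.1 = P.root i) (hy : y.1 = P.root j) :
    2 * extendedForm V Y y x / extendedForm V Y x x = P.pairing j i := by
  rw [extendedForm_apply, extendedForm_apply, hx, hy, ← hP i]
  simp

theorem exists_of_mem_rootSet (E : ExtensionDatum P Y) {x : V × Y} (hx : x ∈ E.rootSet)
    (h : extendedForm V Y x x ≠ 0) : ∃ i, x.1 = P.root i ∧ x.2 ∈ E.Λ i := by
  rcases hx with ⟨h1, -⟩ | ⟨i, -, h1⟩
  · exact absurd (by rw [extendedForm_apply, h1, inner_zero_left]) h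
  · exact ⟨i, h1⟩

theorem coeff_zero {x y : V × Y} (hy : y.1 = 0) :
    2 * extendedForm V Y y x / extendedForm V Y x x = 0 := by
  rw [extendedForm_apply y, hy, inner_zero_left]
  simp

theorem formReflection_mem (E : ExtensionDatum P Y) (hP : P.IsEuclidean) {x y : V × Y}
    (hx : x ∈ E.rootSet) (h : extendedForm V Y x x ≠ 0) (hy : y ∈ E.rootSet) :
    formReflection (extendedForm V Y) x y ∈ E.rootSet := by
  obtain ⟨i, hi, hi'⟩ := E.exists_of_mem_rootSet hx h
  rcases hy with hy | ⟨j, -, hj, hj'⟩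
  · rw [formReflection, coeff_zero hy.1, zero_smul, sub_zero]
    exact Or.inl hy
  · right
    refine ⟨P.reflectionPerm i j, mem_univ _, ?_, ?_⟩
    · rw [formReflection, coeff_eq_pairing hP hi hj, P.root_reflectionPerm,
        P.reflection_apply_root, ← hi, ← hj]
      rfl
    · rw [formReflection, coeff_eq_pairing hP hi hj]
      exact E.sub_smul_mem i j _ hj' _ hi'

theorem span_rootSet [Finite ι] [P.IsRootSystem] [P.IsCrystallographic]
    (E : ExtensionDatum P Y) : Submodule.span ℝ E.rootSet = ⊤ := by
  set S := Submodule.span ℝ E.rootSet with hS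
  have h0 : ∀ i, ¬ P.IsDivisible i → ((P.root i, 0) : V × Y) ∈ S := fun i hi =>
    Submodule.subset_span (Or.inr ⟨i, mem_univ _, rfl, E.zero_mem i hi⟩)
  have h1 : ∀ i, ((P.root i, 0) : V × Y) ∈ S := by
    intro i
    by_cases hi : P.IsDivisible i
    · obtain ⟨j, hj⟩ := hi
      have hnj : ¬ P.IsDivisible j := by
        rintro ⟨k, hk⟩
        obtain ⟨n, hn⟩ := P.exists_value (S := ℤ) k i
        have h2 : P.pairing i i = 4 * P.pairing k i := by
          rw [← P.root_coroot'_eq_pairing, ← P.root_coroot'_eq_pairing, ← smul_eq_mul, ← map_smul]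
          congr 1
          rw [hj, hk, smul_smul]; norm_num
        rw [P.pairing_same, ← hn] at h2
        rw [eq_intCast] at h2
        have h3 : (2 : ℤ) = 4 * n := by exact_mod_cast h2
        omega
      have := S.smul_mem (2 : ℝ) (h0 j hnj)
      rw [hj]
      simpa using this
    · exact h0 i hi
  have h2 : ∀ v : V, ((v, 0) : V × Y) ∈ S := by
    intro v
    have hv : v ∈ Submodule.span ℝ (range P.root) := by simp
    have : Submodule.span ℝ (range P.root) ≤ S.comap (LinearMap.inl ℝ V Y) := by
      rw [Submodule.span_le]
      rintro _ ⟨i, rfl⟩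
      exact h1 i
    exact this hv
  have h3 : ∀ y : Y, ((0, y) : V × Y) ∈ S := by
    intro y
    have hy : y ∈ Submodule.span ℝ (E.Λzero ∪ ⋃ i, E.Λ i) := by
      rw [E.span_eq_top]; trivial
    have : Submodule.span ℝ (E.Λzero ∪ ⋃ i, E.Λ i) ≤ S.comap (LinearMap.inr ℝ V Y) := by
      rw [Submodule.span_le]
      rintro z (hz | hz)
      · exact Submodule.subset_span (Or.inl ⟨rfl, hz⟩)
      · obtain ⟨i, hi⟩ := mem_iUnion.1 hz
        have ha : ((P.root i, z) : V × Y) ∈ S :=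
          Submodule.subset_span (Or.inr ⟨i, mem_univ _, rfl, hi⟩)
        have := S.sub_mem ha (h1 i)
        simpa using this
    exact this hy
  rw [Submodule.eq_top_iff']
  rintro ⟨v, y⟩
  have := S.add_mem (h2 v) (h3 y)
  simpa using this

/-- The affine reflection system `(V ⊕ Y, ⋃ α ⊕ Λ_α, (·,·))` constructed from an extension datum of
type `(Φ, Y)`. -/
def affineReflectionSystem [FiniteDimensional ℝ V] [FiniteDimensional ℝ Y] [Finite ι]
    [P.IsRootSystem] [P.IsCrystallographic] (hP : P.IsEuclidean) (E : ExtensionDatum P Y) :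
    AffineReflectionSystem (V × Y) where
  roots := E.rootSet
  form := extendedForm V Y
  form_symm x y := by
    rw [extendedForm_apply, extendedForm_apply, real_inner_comm]
  zero_mem := Or.inl ⟨rfl, E.zero_mem_zero⟩
  span_eq_top := E.span_rootSet
  imaginary_mem_radical α _ h x := by
    rw [extendedForm_apply] at h ⊢
    rw [inner_self_eq_zero.1 h, inner_zero_left]
  reflection_image α hα h := by
    refine Subset.antisymm ?_ fun y hy => ?_
    · rintro _ ⟨y, hy, rfl⟩
      exact E.formReflection_mem hP hα h hy
    · exact ⟨_, E.formReflection_mem hP hα h hy, formReflection_formReflection _ _ _ h⟩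
  integral α hα h β hβ := by
    obtain ⟨i, hi, -⟩ := E.exists_of_mem_rootSet hα h
    rcases hβ with hβ | ⟨j, -, hj, -⟩
    · exact ⟨0, by rw [coeff_zero hβ.1]; simp⟩
    · obtain ⟨n, hn⟩ := P.exists_value (S := ℤ) j i
      exact ⟨n, by rw [coeff_eq_pairing hP hi hj, ← hn]; simp⟩
  finite α hα h := by
    obtain ⟨i, hi, -⟩ := E.exists_of_mem_rootSet hα h
    refine ((finite_range fun j => P.pairing j i).insert 0).subset ?_
    rintro _ ⟨β, hβ | ⟨j, -, hj, -⟩, rfl⟩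
    · exact Or.inl (coeff_zero hβ.1)
    · exact Or.inr ⟨j, (coeff_eq_pairing hP hi hj).symm⟩

end ExtensionDatum

end

/-! ### Root lengths in an irreducible root system -/

namespace RootPairing

variable {ι V N : Type*} [NormedAddCommGroup V] [InnerProductSpace ℝ V]
  [AddCommGroup N] [Module ℝ N] {P : RootPairing ι ℝ V N}

/-! A root subsystem of Φ amounts to a family of fibres Z_α ⊆ Λ_α, not all empty, closed under (y,
z) ↦ y − (β, α^∨)z. The roots with non-empty fibre form a subsystem of the finite root system. If Ψ
strictly contains the lift of a maximal S, this gradient strictly contains S, so it is everything.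
Hence the lift of S is maximal exactly when every closed family with full fibres over S and
non-empty fibres elsewhere is all of Λ (`isMaximalRootSubsystem_lift_iff`).

The fibres are then controlled by Cartan integers. For non-orthogonal short α and long β, (α, β^∨) =
±1 and (β, α^∨) = ±m. Reflecting in α ⊕ z and then in α ⊕ 0 returns to the same fibre and translates
it. Full short fibres thus make long fibres stable under mΛ_s, and full long fibres make short
fibres stable under ⟨Λ_ℓ⟩. If Λ_ℓ = mΛ_s, respectively Λ_s = ⟨Λ_ℓ⟩, one point of a fibre generates
all of it.

Conversely, mΛ_s ⊆ Λ_ℓ and ⟨Λ_ℓ⟩ ⊆ Λ_s always hold. Cutting the long fibres down to mΛ_s, or the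
short ones to ⟨Λ_ℓ⟩, gives a closed family, which maximality forces to be full. The first of these
needs Λ_s to be a subgroup. This is automatic if two short roots have Cartan integer 1. Otherwise
distinct short roots are orthogonal or opposite, and maximality of the short roots leaves only B₂,
where the subgroup property is assumed. -/

theorem IsEuclidean.pairing_eq (hP : P.IsEuclidean) (i j : ι) :
    P.pairing j i = 2 * inner ℝ (P.root j) (P.root i) / ‖P.root i‖ ^ 2 := by
  rw [← P.root_coroot'_eq_pairing, hP i, real_inner_self_eq_norm_sq]

theorem norm_root_pos (i : ι) : 0 < ‖P.root i‖ := norm_pos_iff.2 (P.ne_zero i)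

theorem IsEuclidean.pairing_mul_norm_sq (hP : P.IsEuclidean) (i j : ι) :
    P.pairing j i * ‖P.root i‖ ^ 2 = 2 * inner ℝ (P.root j) (P.root i) := by
  have := P.norm_root_pos i
  rw [hP.pairing_eq]
  field_simp

theorem IsEuclidean.pairing_mul_norm_sq_comm (hP : P.IsEuclidean) (i j : ι) :
    P.pairing j i * ‖P.root i‖ ^ 2 = P.pairing i j * ‖P.root j‖ ^ 2 := by
  rw [hP.pairing_mul_norm_sq, hP.pairing_mul_norm_sq, real_inner_comm]

theorem IsEuclidean.norm_root_reflectionPerm (hP : P.IsEuclidean) (i j : ι) :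
    ‖P.root (P.reflectionPerm i j)‖ = ‖P.root j‖ := by
  rw [← sq_eq_sq₀ (norm_nonneg _) (norm_nonneg _), P.root_reflectionPerm,
    P.reflection_apply_root, norm_sub_sq_real, norm_smul, inner_smul_right, mul_pow,
    Real.norm_eq_abs, sq_abs]
  linear_combination P.pairing j i * hP.pairing_mul_norm_sq i j

/-- Every non-empty set of roots that is stable under all reflections contains a root that is not
orthogonal to a given one. -/
theorem exists_mem_pairing_ne_zero [P.IsIrreducible] {S : Set ι} (hne : S.Nonempty)
    (hS : ∀ i, ∀ j ∈ S, P.reflectionPerm i j ∈ S) (i : ι) : ∃ k ∈ S, P.pairing k i ≠ 0 := by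
  by_contra! h
  -- The span of S is invariant under reflections, so by irreducibility it is V. If the coroot of i
  -- killed S, it would kill the root i as well, where its value is 2.
  have htop : Submodule.span ℝ (P.root '' S) = ⊤ := by
    refine IsIrreducible.eq_top_of_invtSubmodule_reflection (P := P) _ (fun j => ?_) ?_
    · rw [Module.End.mem_invtSubmodule, Submodule.span_le]
      rintro _ ⟨k, hk, rfl⟩
      refine Submodule.subset_span ⟨_, hS j k hk, ?_⟩
      rw [P.root_reflectionPerm]
      rfl
    · obtain ⟨k, hk⟩ := hne
      intro h0
      have : P.root k ∈ Submodule.span ℝ (P.root '' S) := Submodule.subset_span ⟨k, hk, rfl⟩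
      rw [h0, Submodule.mem_bot] at this
      exact P.ne_zero k this
  have hle : Submodule.span ℝ (P.root '' S) ≤ LinearMap.ker (P.coroot' i) := by
    rw [Submodule.span_le]
    rintro _ ⟨k, hk, rfl⟩
    exact h k hk
  have : P.root i ∈ LinearMap.ker (P.coroot' i) := hle (htop ▸ Submodule.mem_top)
  rw [LinearMap.mem_ker, P.root_coroot'_eq_pairing, P.pairing_same] at this
  norm_num at this

theorem IsEuclidean.exists_norm_eq_pairing_ne_zero [P.IsIrreducible] (hP : P.IsEuclidean)
    (i j : ι) : ∃ k, ‖P.root k‖ = ‖P.root j‖ ∧ P.pairing k i ≠ 0 :=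
  exists_mem_pairing_ne_zero (S := {k | ‖P.root k‖ = ‖P.root j‖}) ⟨j, rfl⟩
    (fun l k hk => (hP.norm_root_reflectionPerm l k).trans hk) i

theorem mem_shortRoots_iff_notMem_longRoots {i : ι} :
    i ∈ P.shortRoots ↔ i ∉ P.longRoots := by
  simp [shortRoots, longRoots]

theorem exists_mem_longRoots [Finite ι] [Nonempty ι] : ∃ i, i ∈ P.longRoots :=
  Finite.exists_max fun i => ‖P.root i‖

theorem norm_eq_of_mem_longRoots {i j : ι} (hi : i ∈ P.longRoots) (hj : j ∈ P.longRoots) :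
    ‖P.root i‖ = ‖P.root j‖ := le_antisymm (hj i) (hi j)

theorem norm_lt_of_mem {i j : ι} (hi : i ∈ P.shortRoots) (hj : j ∈ P.longRoots) :
    ‖P.root i‖ < ‖P.root j‖ := by
  obtain ⟨k, hk⟩ := hi
  exact hk.trans_le (hj k)

theorem IsEuclidean.exists_shortRoot_pairing_ne_zero [P.IsIrreducible] (hP : P.IsEuclidean)
    (hne : P.shortRoots.Nonempty) (i : ι) : ∃ k ∈ P.shortRoots, P.pairing k i ≠ 0 :=
  exists_mem_pairing_ne_zero hne (fun l k ⟨j, hj⟩ =>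
    ⟨j, (hP.norm_root_reflectionPerm l k).trans_lt hj⟩) i

theorem IsEuclidean.exists_longRoot_pairing_ne_zero [Finite ι] [P.IsIrreducible]
    (hP : P.IsEuclidean) (i : ι) :
    ∃ k ∈ P.longRoots, P.pairing k i ≠ 0 := by
  have : Nonempty ι := ⟨i⟩
  exact exists_mem_pairing_ne_zero exists_mem_longRoots (fun l k hk j =>
    (hk j).trans_eq (hP.norm_root_reflectionPerm l k).symm) i

/-! ### Cartan integers and the two root lengths. -/

section Crystallographic

variable [Finite ι] [P.IsCrystallographic] [P.IsReduced]

theorem pairing_mem_of_isReduced (P : RootPairing ι ℝ V N) [P.IsCrystallographic] [P.IsReduced]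
    (i j : ι) :
    ∃ a b : ℤ, P.pairing i j = a ∧ P.pairing j i = b ∧
      (a, b) ∈ ({(0, 0), (1, 1), (-1, -1), (1, 2), (2, 1), (-1, -2), (-2, -1), (1, 3), (3, 1),
        (-1, -3), (-3, -1), (2, 2), (-2, -2)} : Set (ℤ × ℤ)) :=
  ⟨P.pairingIn ℤ i j, P.pairingIn ℤ j i, by rw [← P.algebraMap_pairingIn ℤ]; simp,
    by rw [← P.algebraMap_pairingIn ℤ]; simp,
    P.pairingIn_pairingIn_mem_set_of_isCrystal_of_isRed i j⟩

/-- The two Cartan integers are in the ratio of the squared lengths, so among the finitely many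
possible pairs only ±(1, 2) and ±(1, 3) survive. -/
theorem IsEuclidean.pairing_of_norm_lt (hP : P.IsEuclidean) {i j : ι}
    (hlt : ‖P.root i‖ < ‖P.root j‖) (h0 : P.pairing i j ≠ 0) :
    ∃ ε k : ℝ, (ε = 1 ∨ ε = -1) ∧ (k = 2 ∨ k = 3) ∧ ‖P.root j‖ ^ 2 = k * ‖P.root i‖ ^ 2 ∧
      P.pairing i j = ε ∧ P.pairing j i = ε * k := by
  obtain ⟨a, b, ha, hb, hab⟩ := P.pairing_mem_of_isReduced i j
  have hc := hP.pairing_mul_norm_sq_comm i j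
  have hsq : ‖P.root i‖ ^ 2 < ‖P.root j‖ ^ 2 := by
    have := norm_nonneg (P.root i)
    gcongr
  have hpos := pow_pos (P.norm_root_pos i) 2
  rw [ha] at h0
  rw [ha, hb] at hc ⊢
  simp only [mem_insert_iff, mem_singleton_iff, Prod.mk.injEq] at hab
  rcases hab with h | h | h | h | h | h | h | h | h | h | h | h | h <;> obtain ⟨rfl, rfl⟩ := h <;>
    push_cast at h0 hc <;>
    first
    | exact absurd rfl h0
    | (exfalso; linarith)
    | exact ⟨1, 2, Or.inl rfl, Or.inl rfl, by linarith, by push_cast; linarith,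
        by push_cast; linarith⟩
    | exact ⟨1, 3, Or.inl rfl, Or.inr rfl, by linarith, by push_cast; linarith,
        by push_cast; linarith⟩
    | exact ⟨-1, 2, Or.inr rfl, Or.inl rfl, by linarith, by push_cast; linarith,
        by push_cast; linarith⟩
    | exact ⟨-1, 3, Or.inr rfl, Or.inr rfl, by linarith, by push_cast; linarith,
        by push_cast; linarith⟩

/-- Equal lengths make the two Cartan integers equal. The value ±2 is equality in Cauchy–Schwarz, so
the difference or the sum of the roots has norm zero. -/
theorem IsEuclidean.pairing_of_norm_eq (hP : P.IsEuclidean) {i j : ι}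
    (heq : ‖P.root i‖ = ‖P.root j‖) :
    P.pairing i j = 0 ∨ P.pairing i j = 1 ∨ P.pairing i j = -1 ∨ P.root i = P.root j ∨
      P.root i = -P.root j := by
  obtain ⟨a, b, ha, hb, hab⟩ := P.pairing_mem_of_isReduced i j
  have hc := hP.pairing_mul_norm_sq_comm i j
  have hin := hP.pairing_mul_norm_sq j i
  have hpos := pow_pos (P.norm_root_pos j) 2
  rw [ha, hb, heq] at hc
  have hab' : a = b := by exact_mod_cast (mul_right_cancel₀ hpos.ne' hc).symm
  rw [ha] at hin ⊢
  have hcases : a = 0 ∨ a = 1 ∨ a = -1 ∨ a = 2 ∨ a = -2 := by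
    simp only [mem_insert_iff, mem_singleton_iff, Prod.mk.injEq] at hab
    omega
  rcases hcases with rfl | rfl | rfl | rfl | rfl
  · simp
  · simp
  · simp
  · refine Or.inr (Or.inr (Or.inr (Or.inl (sub_eq_zero.1 (norm_eq_zero.1
      (pow_eq_zero_iff two_ne_zero |>.1 ?_))))))
    rw [norm_sub_sq_real, heq]
    push_cast at hin
    linarith
  · refine Or.inr (Or.inr (Or.inr (Or.inr (eq_neg_of_add_eq_zero_left (norm_eq_zero.1
      (pow_eq_zero_iff two_ne_zero |>.1 ?_))))))
    rw [norm_add_sq_real, heq]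
    push_cast at hin
    linarith

variable [P.IsIrreducible]

theorem IsEuclidean.norm_sq_of_norm_lt (hP : P.IsEuclidean) {i j : ι}
    (hlt : ‖P.root i‖ < ‖P.root j‖) :
    ‖P.root j‖ ^ 2 = 2 * ‖P.root i‖ ^ 2 ∨ ‖P.root j‖ ^ 2 = 3 * ‖P.root i‖ ^ 2 := by
  obtain ⟨k, hk, hk0⟩ := hP.exists_norm_eq_pairing_ne_zero j i
  obtain ⟨-, n, -, hn, h, -⟩ := hP.pairing_of_norm_lt (hk ▸ hlt) hk0
  rw [hk] at h
  rcases hn with rfl | rfl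
  · exact Or.inl h
  · exact Or.inr h

/-- There are at most two root lengths. -/
theorem IsEuclidean.norm_le_of_mem_shortRoots (hP : P.IsEuclidean) {i : ι}
    (hi : i ∈ P.shortRoots) (k : ι) : ‖P.root i‖ ≤ ‖P.root k‖ := by
  by_contra! hlt
  obtain ⟨j, hj⟩ := hi
  have hpos := pow_pos (P.norm_root_pos k) 2
  -- With three lengths, two successive squared ratios in {2, 3} would have their product in {2, 3}
  -- too, but it is 4, 6 or 9.
  rcases hP.norm_sq_of_norm_lt hlt with h1 | h1 <;> rcases hP.norm_sq_of_norm_lt hj with h2 | h2 <;>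
    rcases hP.norm_sq_of_norm_lt (hlt.trans hj) with h3 | h3 <;> linarith

theorem IsEuclidean.norm_eq_of_mem_shortRoots (hP : P.IsEuclidean) {i j : ι}
    (hi : i ∈ P.shortRoots) (hj : j ∈ P.shortRoots) : ‖P.root i‖ = ‖P.root j‖ :=
  le_antisymm (hP.norm_le_of_mem_shortRoots hi j) (hP.norm_le_of_mem_shortRoots hj i)

theorem IsEuclidean.lacingNumber_eq (hP : P.IsEuclidean) {i j : ι}
    (hi : i ∈ P.shortRoots) (hj : j ∈ P.longRoots) :
    P.lacingNumber = ‖P.root j‖ ^ 2 / ‖P.root i‖ ^ 2 := by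
  have : Nonempty ι := ⟨i⟩
  have hsup : ⨆ k, ‖P.root k‖ ^ 2 = ‖P.root j‖ ^ 2 :=
    le_antisymm (ciSup_le fun k => by have := hj k; gcongr)
      (le_ciSup (f := fun k => ‖P.root k‖ ^ 2) (finite_range _).bddAbove j)
  have hinf : ⨅ k, ‖P.root k‖ ^ 2 = ‖P.root i‖ ^ 2 :=
    le_antisymm (ciInf_le (f := fun k => ‖P.root k‖ ^ 2) (finite_range _).bddBelow i)
      (le_ciInf fun k => by have := hP.norm_le_of_mem_shortRoots hi k; gcongr)
  rw [lacingNumber, hsup, hinf]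

/-- The Cartan integers of a short and a long root that are not orthogonal. -/
theorem IsEuclidean.pairing_short_long (hP : P.IsEuclidean) {i j : ι}
    (hi : i ∈ P.shortRoots) (hj : j ∈ P.longRoots) (h0 : P.pairing i j ≠ 0) :
    ∃ ε : ℝ, (ε = 1 ∨ ε = -1) ∧ P.pairing i j = ε ∧ P.pairing j i = ε * P.lacingNumber := by
  obtain ⟨ε, k, hε, -, hk, h1, h2⟩ := hP.pairing_of_norm_lt (norm_lt_of_mem hi hj) h0
  refine ⟨ε, hε, h1, ?_⟩
  have := pow_pos (P.norm_root_pos i) 2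
  rw [h2, hP.lacingNumber_eq hi hj, hk, mul_div_cancel_right₀ _ this.ne']

theorem IsEuclidean.lacingNumber_mem (hP : P.IsEuclidean) {i j : ι}
    (hi : i ∈ P.shortRoots) (hj : j ∈ P.longRoots) :
    P.lacingNumber = 2 ∨ P.lacingNumber = 3 := by
  have := pow_pos (P.norm_root_pos i) 2
  rw [hP.lacingNumber_eq hi hj]
  rcases hP.norm_sq_of_norm_lt (norm_lt_of_mem hi hj) with h | h
  · exact Or.inl (by rw [h, mul_div_cancel_right₀ _ this.ne'])
  · exact Or.inr (by rw [h, mul_div_cancel_right₀ _ this.ne'])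

end Crystallographic

end RootPairing

/-! ### Short roots forming a maximal root subsystem -/

namespace RootPairing

variable {ι V N : Type*} [NormedAddCommGroup V] [InnerProductSpace ℝ V]
  [AddCommGroup N] [Module ℝ N] {P : RootPairing ι ℝ V N}

theorem IsEuclidean.formReflection_root (hP : P.IsEuclidean) (i j : ι) :
    formReflection (innerₗ V) (P.root i) (P.root j) = P.root (P.reflectionPerm i j) := by
  rw [P.root_reflectionPerm, P.reflection_apply, hP i, formReflection]
  rfl

theorem root_reflectionPerm_same (i : ι) : P.root (P.reflectionPerm i i) = -P.root i := by
  rw [P.root_reflectionPerm, P.reflection_apply_self]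

theorem IsEuclidean.reflectionPerm_mem_shortRoots_iff (hP : P.IsEuclidean) {i j : ι} :
    P.reflectionPerm i j ∈ P.shortRoots ↔ j ∈ P.shortRoots := by
  simp only [shortRoots, mem_ofPred_eq, hP.norm_root_reflectionPerm]

theorem IsEuclidean.reflectionPerm_mem_longRoots_iff (hP : P.IsEuclidean) {i j : ι} :
    P.reflectionPerm i j ∈ P.longRoots ↔ j ∈ P.longRoots := by
  simp only [longRoots, mem_ofPred_eq, hP.norm_root_reflectionPerm]

variable [Finite ι] [P.IsCrystallographic] [P.IsReduced] [P.IsIrreducible]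

/-- If no Cartan integer of two short roots is `±1`, then every long root is a sum of two
orthogonal short roots. -/
theorem IsEuclidean.exists_orthogonal_shortRoots (hP : P.IsEuclidean)
    (hs : P.shortRoots.Nonempty)
    (h : ∀ i ∈ P.shortRoots, ∀ j ∈ P.shortRoots, P.pairing i j ≠ 1) {j : ι}
    (hj : j ∈ P.longRoots) :
    ∃ i ∈ P.shortRoots, ∃ k ∈ P.shortRoots, P.root j = P.root i + P.root k ∧
      inner ℝ (P.root i) (P.root k) = 0 ∧ P.lacingNumber = 2 := by
  obtain ⟨i, hi, hij, hji⟩ : ∃ i ∈ P.shortRoots, P.pairing i j = 1 ∧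
      P.pairing j i = P.lacingNumber := by
    obtain ⟨i, hi, hij⟩ := hP.exists_shortRoot_pairing_ne_zero hs j
    obtain ⟨ε, rfl | rfl, h1, h2⟩ := hP.pairing_short_long hi hj hij
    · exact ⟨i, hi, h1, by rw [h2, one_mul]⟩
    · refine ⟨P.reflectionPerm i i, hP.reflectionPerm_mem_shortRoots_iff.2 hi, ?_, ?_⟩
      · rw [P.pairing_reflectionPerm_self_left, h1, neg_neg]
      · rw [P.pairing_reflectionPerm_self_right, h2]
        ring
  -- Since (i, j^∨) = 1, this root −s_j(i) is j − i, and it is short like i.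
  set k := P.reflectionPerm (P.reflectionPerm j i) (P.reflectionPerm j i) with hk
  have hks : k ∈ P.shortRoots := by
    rw [hk, hP.reflectionPerm_mem_shortRoots_iff, hP.reflectionPerm_mem_shortRoots_iff]
    exact hi
  have hkr : P.root k = P.root j - P.root i := by
    rw [hk, root_reflectionPerm_same, P.root_reflectionPerm, P.reflection_apply_root, hij,
      one_smul, neg_sub]
  have hki : P.pairing k i = P.lacingNumber - 2 := by
    rw [← P.root_coroot'_eq_pairing, hkr, map_sub, P.root_coroot'_eq_pairing,
      P.root_coroot'_eq_pairing, P.pairing_same, hji]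
  -- Here (k, i^∨) = m − 2: the value m = 3 would give the excluded integer 1, and m = 2 gives
  -- orthogonality.
  have hm : P.lacingNumber = 2 := by
    refine (hP.lacingNumber_mem hi hj).resolve_right fun h3 => h k hks i hi ?_
    rw [hki, h3]
    norm_num
  refine ⟨i, hi, k, hks, by rw [hkr]; abel, ?_, hm⟩
  have := hP.pairing_mul_norm_sq i k
  rw [hki, hm, real_inner_comm] at this
  linarith

/-- Replacing i by its negative turns a Cartan integer −1 into 1, so both are excluded. -/
theorem IsEuclidean.inner_eq_zero_or_of_pairing_ne_one (hP : P.IsEuclidean)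
    (h : ∀ i ∈ P.shortRoots, ∀ j ∈ P.shortRoots, P.pairing i j ≠ 1) {i j : ι}
    (hi : i ∈ P.shortRoots) (hj : j ∈ P.shortRoots) :
    inner ℝ (P.root i) (P.root j) = 0 ∨ P.root i = P.root j ∨ P.root i = -P.root j := by
  rcases hP.pairing_of_norm_eq (hP.norm_eq_of_mem_shortRoots hi hj) with h0 | h0 | h0 | h0
  · have := hP.pairing_mul_norm_sq j i
    rw [h0] at this
    exact Or.inl (by linarith)
  · exact absurd h0 (h i hi j hj)
  · refine absurd ?_ (h _ ((hP.reflectionPerm_mem_shortRoots_iff (i := i)).2 hi) j hj)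
    rw [P.pairing_reflectionPerm_self_left, h0, neg_neg]
  · exact Or.inr h0

/-- If the short roots form a maximal root subsystem and no Cartan integer of two short roots
is `1`, then the root system is of type `B₂`. -/
theorem IsEuclidean.isTypeB2_of_isMaximalRootSubsystem (hP : P.IsEuclidean)
    (hmax : IsMaximalRootSubsystem (innerₗ V) (range P.root) (P.root '' P.shortRoots))
    (h : ∀ i ∈ P.shortRoots, ∀ j ∈ P.shortRoots, P.pairing i j ≠ 1) : P.IsTypeB2 := by
  have hs : P.shortRoots.Nonempty := hmax.1.1.of_image
  have : Nonempty ι := ⟨hs.some⟩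
  obtain ⟨j, hj⟩ := P.exists_mem_longRoots
  obtain ⟨i, hi, k, hk, hjik, hik, hm⟩ := hP.exists_orthogonal_shortRoots hs h hj
  set e := P.root i with he
  set f := P.root k with hf
  have hnorm : ‖e‖ = ‖f‖ := hP.norm_eq_of_mem_shortRoots hi hk
  have hpos : 0 < ‖e‖ := P.norm_root_pos i
  set U : Submodule ℝ V := Submodule.span ℝ {e, f} with hU
  have heU : e ∈ U := Submodule.subset_span (by simp)
  have hfU : f ∈ U := Submodule.subset_span (by simp)
  have hperp : ∀ l ∈ P.shortRoots, inner ℝ (P.root l) e = 0 → inner ℝ (P.root l) f = 0 →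
      ∀ u ∈ U, inner ℝ u (P.root l) = 0 := by
    intro l _ h1 h2 u hu
    obtain ⟨a, b, rfl⟩ := Submodule.mem_span_pair.1 hu
    rw [inner_add_left, real_inner_smul_left, real_inner_smul_left, real_inner_comm, h1,
      real_inner_comm, h2]
    ring
  have hdich : ∀ l ∈ P.shortRoots, (P.root l = e ∨ P.root l = -e ∨ P.root l = f ∨
      P.root l = -f) ∨ ∀ u ∈ U, inner ℝ u (P.root l) = 0 := by
    intro l hl
    rcases hP.inner_eq_zero_or_of_pairing_ne_one h hl hi with h1 | h1 | h1
    · rcases hP.inner_eq_zero_or_of_pairing_ne_one h hl hk with h2 | h2 | h2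
      · exact Or.inr (hperp l hl h1 h2)
      · exact Or.inl (Or.inr (Or.inr (Or.inl h2)))
      · exact Or.inl (Or.inr (Or.inr (Or.inr h2)))
    · exact Or.inl (Or.inl h1)
    · exact Or.inl (Or.inr (Or.inl h1))
  -- Each short root lies in the plane U or is orthogonal to it, so its reflection preserves U. The
  -- short roots together with all roots in U therefore form a subsystem. It contains the long root
  -- e + f, so maximality makes it everything.
  have hΨ : range P.root = P.root '' {l | l ∈ P.shortRoots ∨ P.root l ∈ U} := by
    by_contra hne
    have hsub : IsRootSubsystem (innerₗ V) (range P.root)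
        (P.root '' {l | l ∈ P.shortRoots ∨ P.root l ∈ U}) := by
      refine ⟨⟨e, i, Or.inl hi, rfl⟩, image_subset_range _ _, ?_⟩
      rintro _ ⟨a, ha, rfl⟩ _ ⟨b, hb, rfl⟩
      rw [hP.formReflection_root]
      refine ⟨_, ?_, rfl⟩
      rcases hb with hb | hb
      · exact Or.inl (hP.reflectionPerm_mem_shortRoots_iff.2 hb)
      · refine Or.inr ?_
        have haU : P.root a ∈ U ∨ ∀ u ∈ U, inner ℝ u (P.root a) = 0 := by
          rcases ha with ha | ha
          · refine (hdich a ha).imp_left ?_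
            rintro (h1 | h1 | h1 | h1) <;> rw [h1]
            · exact heU
            · exact U.neg_mem heU
            · exact hfU
            · exact U.neg_mem hfU
          · exact Or.inl ha
        rw [P.root_reflectionPerm, P.reflection_apply_root]
        rcases haU with haU | haU
        · exact U.sub_mem hb (U.smul_mem _ haU)
        · rwa [hP.pairing_eq, haU _ hb, mul_zero, zero_div, zero_smul, sub_zero]
    have := hmax.2.2 _ hsub (image_mono fun l hl => Or.inl hl) (Ne.symm hne)
    have hjm : P.root j ∈ P.root '' P.shortRoots := by
      rw [this]
      exact ⟨j, Or.inr (by rw [hjik]; exact U.add_mem heU hfU), rfl⟩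
    rw [P.root.injective.mem_set_image] at hjm
    exact mem_shortRoots_iff_notMem_longRoots.1 hjm hj
  have hlong : ∀ l ∈ P.longRoots, P.root l ∈ U := by
    intro l hl
    have : P.root l ∈ P.root '' {l | l ∈ P.shortRoots ∨ P.root l ∈ U} := hΨ ▸ mem_range_self l
    rw [P.root.injective.mem_set_image] at this
    exact this.resolve_left fun h' => mem_shortRoots_iff_notMem_longRoots.1 h' hl
  have hshort : ∀ l ∈ P.shortRoots, P.root l = e ∨ P.root l = -e ∨ P.root l = f ∨
      P.root l = -f := by
    intro l hl
    -- All long roots lie in U, so a short root orthogonal to U would be orthogonal to every long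
    -- root, against irreducibility.
    refine (hdich l hl).resolve_right fun h1 => ?_
    obtain ⟨n, hn, hn0⟩ := hP.exists_longRoot_pairing_ne_zero l
    exact hn0 (by rw [hP.pairing_eq, h1 _ (hlong n hn), mul_zero, zero_div])
  refine ⟨e, f, P.ne_zero i, hnorm, hik, Subset.antisymm ?_ ?_⟩
  · rintro _ ⟨l, rfl⟩
    simp only [mem_insert_iff, mem_singleton_iff]
    by_cases hl : l ∈ P.longRoots
    · obtain ⟨a, b, hab⟩ := Submodule.mem_span_pair.1 (hlong l hl)
      have hcoef : ∀ s ∈ P.shortRoots, P.pairing l s = 0 ∨ P.pairing l s = 2 ∨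
          P.pairing l s = -2 := by
        intro s hs'
        by_cases h0 : P.pairing s l = 0
        · exact Or.inl (P.pairing_eq_zero_iff'.1 h0)
        · obtain ⟨ε, rfl | rfl, -, h2⟩ := hP.pairing_short_long hs' hl h0
          · exact Or.inr (Or.inl (by rw [h2, hm, one_mul]))
          · exact Or.inr (Or.inr (by rw [h2, hm]; ring))
      have hfe : inner ℝ f e = 0 := by rw [real_inner_comm]; exact hik
      have ha : P.pairing l i = 2 * a := by
        rw [hP.pairing_eq, ← hab, inner_add_left, real_inner_smul_left, real_inner_smul_left,
          ← he, hfe, real_inner_self_eq_norm_sq]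
        field_simp
        ring
      have hb : P.pairing l k = 2 * b := by
        rw [hP.pairing_eq, ← hab, inner_add_left, real_inner_smul_left, real_inner_smul_left,
          ← hf, hik, real_inner_self_eq_norm_sq, ← hnorm]
        field_simp
        ring
      -- The squared length ratio is m = 2. As the Cartan integers 2a and 2b lie in {0, ±2}, this
      -- forces a, b = ±1.
      have hsum : a ^ 2 + b ^ 2 = 2 := by
        have h1 := hP.lacingNumber_eq hi hl
        rw [hm, ← hab, norm_add_sq_real, real_inner_smul_left, real_inner_smul_right, hik,
          norm_smul, norm_smul, mul_pow, mul_pow, ← hnorm, Real.norm_eq_abs, Real.norm_eq_abs,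
          sq_abs, sq_abs, ← he] at h1
        rw [eq_div_iff (pow_pos hpos 2).ne'] at h1
        refine mul_right_cancel₀ (pow_pos hpos 2).ne' ?_
        linear_combination -h1
      have h1 := hcoef i hi
      have h2 := hcoef k hk
      rw [ha] at h1
      rw [hb] at h2
      have h1' : a = 0 ∨ a = 1 ∨ a = -1 := by
        rcases h1 with h1 | h1 | h1
        · exact Or.inl (by linarith)
        · exact Or.inr (Or.inl (by linarith))
        · exact Or.inr (Or.inr (by linarith))
      have h2' : b = 0 ∨ b = 1 ∨ b = -1 := by
        rcases h2 with h1 | h1 | h1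
        · exact Or.inl (by linarith)
        · exact Or.inr (Or.inl (by linarith))
        · exact Or.inr (Or.inr (by linarith))
      rw [← hab]
      rcases h1' with rfl | rfl | rfl <;> rcases h2' with rfl | rfl | rfl <;>
        norm_num at hsum <;> simp [← sub_eq_add_neg]
    · have := hshort l (mem_shortRoots_iff_notMem_longRoots.2 hl)
      tauto
  · have hneg : ∀ v ∈ range P.root, -v ∈ range P.root := by
      rintro _ ⟨l, rfl⟩
      exact ⟨_, root_reflectionPerm_same l⟩
    have he' : e ∈ range P.root := ⟨i, rfl⟩
    have hf' : f ∈ range P.root := ⟨k, rfl⟩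
    have hef : e + f ∈ range P.root := ⟨j, hjik⟩
    have hef' : e - f ∈ range P.root := by
      refine ⟨P.reflectionPerm k j, ?_⟩
      have h2 : P.pairing j k = 2 := by
        rw [hP.pairing_eq, hjik, inner_add_left, hik, ← hf, real_inner_self_eq_norm_sq, ← hnorm]
        field_simp
        ring
      rw [P.root_reflectionPerm, P.reflection_apply_root, h2, hjik, two_smul]
      abel
    rintro v (rfl | rfl | rfl | rfl | rfl | rfl | rfl | rfl)
    · exact he'
    · exact hneg _ he'
    · exact hf'
    · exact hneg _ hf'
    · exact hef
    · exact hef'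
    · rw [neg_add_eq_sub, ← neg_sub]
      exact hneg _ hef'
    · rw [← neg_add']
      exact hneg _ hef

end RootPairing

/-! ### Extension data of reduced irreducible root systems -/

namespace ExtensionDatum

variable {ι V N Y : Type*} [NormedAddCommGroup V] [InnerProductSpace ℝ V]
  [AddCommGroup N] [Module ℝ N] [AddCommGroup Y] [Module ℝ Y] {P : RootPairing ι ℝ V N}

/-- A subfamily of an extension datum whose lift is closed under reflections. -/
structure IsClosedSubfamily (E : ExtensionDatum P Y) (Z : ι → Set Y) : Prop where
  subset : ∀ i, Z i ⊆ E.Λ i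
  sub_smul_mem : ∀ i j, ∀ y ∈ Z j, ∀ z ∈ Z i, y - P.pairing j i • z ∈ Z (P.reflectionPerm i j)

theorem formReflection_eq (hP : P.IsEuclidean) (i j : ι) (y z : Y) :
    formReflection (extendedForm V Y) (P.root i, z) (P.root j, y) =
      (P.root (P.reflectionPerm i j), y - P.pairing j i • z) := by
  rw [formReflection, coeff_eq_pairing hP rfl rfl, P.root_reflectionPerm,
    P.reflection_apply_root]
  rfl

theorem mk_mem_lift {E : ExtensionDatum P Y} {S : Set ι} {i : ι} {y : Y} :
    (P.root i, y) ∈ E.lift S ↔ i ∈ S ∧ y ∈ E.Λ i := by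
  constructor
  · rintro ⟨j, hj, hij, hy⟩
    obtain rfl := P.root.injective hij
    exact ⟨hj, hy⟩
  · rintro ⟨hi, hy⟩
    exact ⟨i, hi, rfl, hy⟩

theorem lift_mono (E : ExtensionDatum P Y) {S T : Set ι} (h : S ⊆ T) : E.lift S ⊆ E.lift T :=
  fun _ ⟨i, hi, hx⟩ => ⟨i, h hi, hx⟩

theorem IsClosedSubfamily.isRootSubsystem {E : ExtensionDatum P Y} (hP : P.IsEuclidean)
    {Z : ι → Set Y} (hZ : E.IsClosedSubfamily Z) (hne : ∃ i, (Z i).Nonempty) :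
    IsRootSubsystem (extendedForm V Y) (E.lift univ) {x | ∃ i, x.1 = P.root i ∧ x.2 ∈ Z i} := by
  refine ⟨?_, ?_, ?_⟩
  · obtain ⟨i, y, hy⟩ := hne
    exact ⟨(P.root i, y), i, rfl, hy⟩
  · rintro x ⟨i, hx, hy⟩
    exact ⟨i, mem_univ _, hx, hZ.subset i hy⟩
  · rintro ⟨_, z⟩ ⟨i, rfl, hz⟩ ⟨_, y⟩ ⟨j, rfl, hy⟩
    rw [formReflection_eq hP]
    exact ⟨_, rfl, hZ.sub_smul_mem i j y hy z hz⟩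

theorem isClosedSubfamily_of_isRootSubsystem {E : ExtensionDatum P Y} (hP : P.IsEuclidean)
    {Ψ : Set (V × Y)} (hΨ : IsRootSubsystem (extendedForm V Y) (E.lift univ) Ψ) :
    E.IsClosedSubfamily fun i => {y | (P.root i, y) ∈ Ψ} where
  subset i y hy := (mk_mem_lift.1 (hΨ.2.1 hy)).2
  sub_smul_mem i j y hy z hz := by
    have := hΨ.2.2 _ hz _ hy
    rwa [formReflection_eq hP] at this

theorem realRoots_eq_lift_univ [FiniteDimensional ℝ V] [FiniteDimensional ℝ Y] [Finite ι]
    [P.IsRootSystem] [P.IsCrystallographic] (hP : P.IsEuclidean) (E : ExtensionDatum P Y) :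
    (E.affineReflectionSystem hP).realRoots = E.lift univ := by
  ext x
  constructor
  · rintro ⟨h | h, h0⟩
    · exact absurd (inner_self_eq_zero.2 h.1) h0
    · exact h
  · rintro ⟨i, hi, hx, hy⟩
    refine ⟨Or.inr ⟨i, hi, hx, hy⟩, fun h => P.ne_zero i ?_⟩
    rw [← hx]
    exact inner_self_eq_zero.1 h

/-! ### Symmetries of the sets Λ_α and the criterion for a lift to be maximal. -/

section Reduced

variable [P.IsReduced] (E : ExtensionDatum P Y)

/-- A reduced root system has no divisible roots. -/
theorem zero_mem_of_isReduced (i : ι) : (0 : Y) ∈ E.Λ i := by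
  refine E.zero_mem i ?_
  rintro ⟨j, hj⟩
  have : IsAddTorsionFree V := .of_isTorsionFree ℝ V
  refine P.nsmul_notMem_range_root (n := 2) (i := j) ⟨i, ?_⟩
  rw [hj, ← Nat.cast_smul_eq_nsmul ℝ]
  norm_num

theorem Λ_reflectionPerm (i j : ι) : E.Λ (P.reflectionPerm i j) = E.Λ j := by
  have h : ∀ k, E.Λ k ⊆ E.Λ (P.reflectionPerm i k) := fun k y hy => by
    have := E.sub_smul_mem i k y hy 0 (E.zero_mem_of_isReduced i)
    rwa [smul_zero, sub_zero] at this
  refine Subset.antisymm ?_ (h j)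
  have := h (P.reflectionPerm i j)
  rwa [P.reflectionPerm_self] at this

/-- Reflections do not change Λ_j, so the extension datum axiom becomes a translation property of a
single set. -/
theorem sub_pairing_smul_mem {i j : ι} {y z : Y} (hy : y ∈ E.Λ j) (hz : z ∈ E.Λ i) :
    y - P.pairing j i • z ∈ E.Λ j := by
  rw [← E.Λ_reflectionPerm i j]
  exact E.sub_smul_mem i j y hy z hz

theorem neg_mem {i : ι} {y : Y} (hy : y ∈ E.Λ i) : -y ∈ E.Λ i := by
  have := E.sub_pairing_smul_mem hy hy
  rwa [P.pairing_same, two_smul, sub_add_cancel_left] at this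

theorem neg_mem_Λs {y : Y} (hy : y ∈ E.Λs) : -y ∈ E.Λs := by
  obtain ⟨i, hi, hyi⟩ := mem_iUnion₂.1 hy
  exact mem_iUnion₂.2 ⟨i, hi, E.neg_mem hyi⟩

theorem neg_mem_Λl {y : Y} (hy : y ∈ E.Λl) : -y ∈ E.Λl := by
  obtain ⟨i, hi, hyi⟩ := mem_iUnion₂.1 hy
  exact mem_iUnion₂.2 ⟨i, hi, E.neg_mem hyi⟩

theorem zero_mem_Λl [Finite ι] [Nonempty ι] : (0 : Y) ∈ E.Λl := by
  obtain ⟨i, hi⟩ := P.exists_mem_longRoots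
  exact mem_iUnion₂.2 ⟨i, hi, E.zero_mem_of_isReduced i⟩

/-- Criterion for the lift of a maximal root subsystem to be maximal. -/
theorem isMaximalRootSubsystem_lift_iff [Finite ι] [FiniteDimensional ℝ V] [FiniteDimensional ℝ Y]
    [P.IsRootSystem] [P.IsCrystallographic] (hP : P.IsEuclidean) {S : Set ι}
    (hS : IsMaximalRootSubsystem (innerₗ V) (range P.root) (P.root '' S)) :
    IsMaximalRootSubsystem (E.affineReflectionSystem hP).form
      (E.affineReflectionSystem hP).realRoots (E.lift S) ↔
    ∀ Z : ι → Set Y, E.IsClosedSubfamily Z → (∀ i ∈ S, E.Λ i ⊆ Z i) →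
      (∀ i, (Z i).Nonempty) → ∀ i, E.Λ i ⊆ Z i := by
  rw [E.realRoots_eq_lift_univ hP]
  change IsMaximalRootSubsystem (extendedForm V Y) _ _ ↔ _
  obtain ⟨k, hk⟩ : ∃ k, k ∉ S := by
    by_contra! h
    exact hS.2.1 (by rw [eq_univ_of_forall h, image_univ])
  constructor
  · intro hmax Z hZ hSZ hne i y hy
    by_contra hyZ
    -- If Z misses a point, its total set is a proper subsystem above the lift of S, hence equal to
    -- that lift. But Z has a point over k ∉ S.
    have := hmax.2.2 _ (hZ.isRootSubsystem hP ⟨k, hne k⟩) ?_ ?_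
    · obtain ⟨z, hz⟩ := hne k
      have hmem : (P.root k, z) ∈ E.lift S := by
        rw [this]
        exact ⟨k, rfl, hz⟩
      exact hk (mk_mem_lift.1 hmem).1
    · rintro ⟨_, z⟩ ⟨j, hj, rfl, hz⟩
      exact ⟨j, rfl, hSZ j hj hz⟩
    · intro heq
      have hmem : (P.root i, y) ∈ E.lift univ := mk_mem_lift.2 ⟨mem_univ _, hy⟩
      rw [← heq] at hmem
      obtain ⟨j, hj, hyj⟩ := hmem
      obtain rfl := P.root.injective hj
      exact hyZ hyj
  · intro h
    have hclosed : ∀ i ∈ S, ∀ j ∈ S, P.reflectionPerm i j ∈ S := by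
      intro i hi j hj
      have := hS.1.2.2 _ ⟨i, hi, rfl⟩ _ ⟨j, hj, rfl⟩
      rwa [hP.formReflection_root, P.root.injective.mem_set_image] at this
    refine ⟨⟨?_, E.lift_mono (subset_univ S), ?_⟩, ?_, ?_⟩
    · obtain ⟨i, hi⟩ := hS.1.1.of_image
      exact ⟨_, mk_mem_lift.2 ⟨hi, E.zero_mem_of_isReduced i⟩⟩
    · rintro ⟨_, z⟩ ⟨i, hi, rfl, hz⟩ ⟨_, y⟩ ⟨j, hj, rfl, hy⟩
      rw [formReflection_eq hP]
      exact mk_mem_lift.2 ⟨hclosed i hi j hj, E.sub_smul_mem i j y hy z hz⟩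
    · intro heq
      have hmem : (P.root k, (0 : Y)) ∈ E.lift univ :=
        mk_mem_lift.2 ⟨mem_univ _, E.zero_mem_of_isReduced k⟩
      rw [← heq] at hmem
      exact hk (mk_mem_lift.1 hmem).1
    · intro Ψ hΨ hle hne
      by_contra hSΨ
      have hZ := isClosedSubfamily_of_isRootSubsystem hP hΨ
      have hSZ : ∀ i ∈ S, E.Λ i ⊆ {y | (P.root i, y) ∈ Ψ} :=
        fun i hi y hy => hle (mk_mem_lift.2 ⟨hi, hy⟩)
      refine hne (Subset.antisymm hΨ.2.1 ?_)
      suffices hall : ∀ i, {y | (P.root i, y) ∈ Ψ}.Nonempty by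
        rintro ⟨_, y⟩ ⟨i, -, rfl, hy⟩
        exact h _ hZ hSZ hall i hy
      -- The gradient of Ψ. A point of Ψ outside the lift of S lies over a root outside S, so G is
      -- strictly larger than S and maximality of S makes it everything.
      set G : Set ι := {i | {y | (P.root i, y) ∈ Ψ}.Nonempty} with hG
      have hSG : S ⊆ G := fun i hi => ⟨0, hSZ i hi (E.zero_mem_of_isReduced i)⟩
      have hGsub : IsRootSubsystem (innerₗ V) (range P.root) (P.root '' G) := by
        refine ⟨hS.1.1.mono (image_mono hSG), image_subset_range _ _, ?_⟩
        rintro _ ⟨i, ⟨z, hz⟩, rfl⟩ _ ⟨j, ⟨y, hy⟩, rfl⟩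
        rw [hP.formReflection_root]
        exact ⟨_, ⟨_, hZ.sub_smul_mem i j y hy z hz⟩, rfl⟩
      obtain ⟨x, hx, hxS⟩ := not_subset.1 fun h' => hSΨ (Subset.antisymm hle h')
      obtain ⟨i, -, hxi, hi⟩ := hΨ.2.1 hx
      obtain ⟨_, y⟩ := x
      obtain rfl : _ = P.root i := hxi
      have hGtop : P.root '' G = range P.root := by
        by_contra hG'
        have := hS.2.2 _ hGsub (image_mono hSG) hG'
        have hmem : P.root i ∈ P.root '' S := by
          rw [this]
          exact ⟨i, ⟨y, hx⟩, rfl⟩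
        rw [P.root.injective.mem_set_image] at hmem
        exact hxS (mk_mem_lift.2 ⟨hmem, hi⟩)
      intro l
      have hl : P.root l ∈ P.root '' G := hGtop ▸ mem_range_self l
      rwa [P.root.injective.mem_set_image] at hl

/-! ### Dependence on length, and relations between Λ_s and Λ_ℓ. -/

variable [Finite ι] [P.IsCrystallographic] [P.IsIrreducible]

/-- `Λ_α` only depends on the length of `α`. -/
theorem Λ_eq_of_norm_eq (hP : P.IsEuclidean) {i j : ι} (hij : ‖P.root i‖ = ‖P.root j‖) :
    E.Λ i = E.Λ j := by
  -- Irreducibility replaces j by a root k with the same Λ and length that is not orthogonal to i.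
  -- Then k is carried to i by reflections: −s_i(k) = s_k(i) if the Cartan integer is 1, and s_i(k)
  -- = s_k(i) if it is −1.
  obtain ⟨k, ⟨hk, hkj⟩, h0⟩ := RootPairing.exists_mem_pairing_ne_zero
    (P := P) (S := {k | ‖P.root k‖ = ‖P.root j‖ ∧ E.Λ k = E.Λ j}) ⟨j, rfl, rfl⟩
    (fun l k hk => ⟨(hP.norm_root_reflectionPerm l k).trans hk.1,
      (E.Λ_reflectionPerm l k).trans hk.2⟩) i
  rw [← hkj]
  have hnorm := hk.trans hij.symm
  have hcomm : P.pairing i k = P.pairing k i := by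
    have := hP.pairing_mul_norm_sq_comm k i
    rw [hnorm] at this
    exact mul_right_cancel₀ (pow_pos (P.norm_root_pos i) 2).ne' this
  have key : ∀ l, P.root l = P.root (P.reflectionPerm k i) →
      E.Λ l = E.Λ i := fun l hl => by
    rw [P.root.injective hl, E.Λ_reflectionPerm]
  rcases hP.pairing_of_norm_eq hnorm with h | h | h | h | h
  · exact absurd h h0
  · rw [← key (P.reflectionPerm (P.reflectionPerm i k) (P.reflectionPerm i k)),
      E.Λ_reflectionPerm, E.Λ_reflectionPerm]
    rw [RootPairing.root_reflectionPerm_same, P.root_reflectionPerm, P.root_reflectionPerm,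
      P.reflection_apply_root, P.reflection_apply_root, hcomm, h, one_smul, one_smul, neg_sub]
  · rw [← key (P.reflectionPerm i k), E.Λ_reflectionPerm]
    rw [P.root_reflectionPerm, P.root_reflectionPerm,
      P.reflection_apply_root, P.reflection_apply_root, hcomm, h]
    module
  · rw [P.root.injective h]
  · rw [← E.Λ_reflectionPerm i i]
    congr 1
    apply P.root.injective
    rw [RootPairing.root_reflectionPerm_same, h]

theorem Λs_eq (hP : P.IsEuclidean) {i : ι} (hi : i ∈ P.shortRoots) : E.Λs = E.Λ i := by
  refine Subset.antisymm (iUnion₂_subset fun j hj => ?_)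
    (subset_biUnion_of_mem (u := E.Λ) hi)
  exact (E.Λ_eq_of_norm_eq hP (hP.norm_eq_of_mem_shortRoots hj hi)).subset

theorem Λl_eq (hP : P.IsEuclidean) {i : ι} (hi : i ∈ P.longRoots) : E.Λl = E.Λ i := by
  refine Subset.antisymm (iUnion₂_subset fun j hj => ?_)
    (subset_biUnion_of_mem (u := E.Λ) hi)
  exact (E.Λ_eq_of_norm_eq hP (RootPairing.norm_eq_of_mem_longRoots hj hi)).subset

/-- The Cartan integer of a short root against a non-orthogonal long coroot is ±1, and Λ_ℓ is
symmetric. -/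
theorem add_mem_Λs (hP : P.IsEuclidean) (hs : P.shortRoots.Nonempty) {y z : Y}
    (hy : y ∈ E.Λs) (hz : z ∈ E.Λl) : y + z ∈ E.Λs := by
  obtain ⟨j, hj, hzj⟩ := mem_iUnion₂.1 hz
  obtain ⟨i, hi, hij⟩ := hP.exists_shortRoot_pairing_ne_zero hs j
  obtain ⟨ε, hε, h1, -⟩ := hP.pairing_short_long hi hj hij
  rw [E.Λs_eq hP hi] at hy ⊢
  rcases hε with rfl | rfl
  · have := E.sub_pairing_smul_mem hy (E.neg_mem hzj)
    rwa [h1, one_smul, sub_neg_eq_add] at this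
  · have := E.sub_pairing_smul_mem hy hzj
    rwa [h1, neg_one_smul, sub_neg_eq_add] at this

/-- The Cartan integer of a long root against a non-orthogonal short coroot is ±m, and Λ_s is
symmetric. -/
theorem add_lacingNumber_smul_mem_Λl (hP : P.IsEuclidean) {y z : Y}
    (hy : y ∈ E.Λl) (hz : z ∈ E.Λs) : y + P.lacingNumber • z ∈ E.Λl := by
  obtain ⟨i, hi, hzi⟩ := mem_iUnion₂.1 hz
  obtain ⟨j, hj, hji⟩ := hP.exists_longRoot_pairing_ne_zero i
  obtain ⟨ε, hε, -, h2⟩ := hP.pairing_short_long hi hj (mt P.pairing_eq_zero_iff'.1 hji)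
  rw [E.Λl_eq hP hj] at hy ⊢
  rcases hε with rfl | rfl
  · have := E.sub_pairing_smul_mem hy (E.neg_mem hzi)
    rwa [h2, one_mul, smul_neg, sub_neg_eq_add] at this
  · have := E.sub_pairing_smul_mem hy hzi
    rwa [h2, neg_one_mul, neg_smul, sub_neg_eq_add] at this

theorem lacingNumber_smul_Λs_subset (hP : P.IsEuclidean) :
    P.lacingNumber • E.Λs ⊆ E.Λl := by
  rintro _ ⟨y, hy, rfl⟩
  have : Nonempty ι := ⟨(mem_iUnion₂.1 hy).choose⟩
  have := E.add_lacingNumber_smul_mem_Λl hP E.zero_mem_Λl hy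
  rwa [zero_add] at this

theorem closure_Λl_subset (hP : P.IsEuclidean) (hs : P.shortRoots.Nonempty) :
    (AddSubgroup.closure E.Λl : Set Y) ⊆ E.Λs := by
  obtain ⟨i, hi⟩ := hs
  intro y hy
  induction hy using AddSubgroup.closure_induction_right with
  | zero => rw [E.Λs_eq hP hi]; exact E.zero_mem_of_isReduced i
  | add_right x _ z hz hx => exact E.add_mem_Λs hP ⟨i, hi⟩ hx hz
  | add_neg_cancel x _ z hz hx => exact E.add_mem_Λs hP ⟨i, hi⟩ hx (E.neg_mem_Λl hz)

end Reduced

end ExtensionDatum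

/-! ### The two maximality criteria. -/

namespace ExtensionDatum

variable {ι V N Y : Type*} [Finite ι] [NormedAddCommGroup V] [InnerProductSpace ℝ V]
  [AddCommGroup N] [Module ℝ N] [AddCommGroup Y] [Module ℝ Y]
  {P : RootPairing ι ℝ V N} [P.IsCrystallographic] [P.IsReduced] [P.IsIrreducible]

/-- `Λ_s` is closed under addition. -/
theorem add_mem_Λs_of_isMaximalRootSubsystem (hP : P.IsEuclidean) (E : ExtensionDatum P Y)
    (hB : P.IsTypeB2 → ∃ G : AddSubgroup Y, (G : Set Y) = E.Λs)
    (hmax : IsMaximalRootSubsystem (innerₗ V) (range P.root) (P.root '' P.shortRoots))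
    {y z : Y} (hy : y ∈ E.Λs) (hz : z ∈ E.Λs) : y + z ∈ E.Λs := by
  by_cases h : ∀ i ∈ P.shortRoots, ∀ j ∈ P.shortRoots, P.pairing i j ≠ 1
  · obtain ⟨G, hG⟩ := hB (hP.isTypeB2_of_isMaximalRootSubsystem hmax h)
    rw [← hG] at hy hz ⊢
    exact G.add_mem hy hz
  · push Not at h
    obtain ⟨i, hi, j, hj, hij⟩ := h
    have hzj := E.neg_mem_Λs hz
    rw [E.Λs_eq hP hj] at hzj
    rw [E.Λs_eq hP hi] at hy ⊢
    have := E.sub_pairing_smul_mem hy hzj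
    rwa [hij, one_smul, sub_neg_eq_add] at this

variable [FiniteDimensional ℝ V] [FiniteDimensional ℝ Y] [P.IsRootSystem]

/-- Maximality of the lift of the short roots. -/
theorem isMaximalRootSubsystem_lift_shortRoots_iff (hP : P.IsEuclidean) (E : ExtensionDatum P Y)
    (hB : P.IsTypeB2 → ∃ G : AddSubgroup Y, (G : Set Y) = E.Λs)
    (hmax : IsMaximalRootSubsystem (innerₗ V) (range P.root) (P.root '' P.shortRoots)) :
    IsMaximalRootSubsystem (E.affineReflectionSystem hP).form
      (E.affineReflectionSystem hP).realRoots (E.lift P.shortRoots) ↔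
    E.Λl = P.lacingNumber • E.Λs := by
  have hs : P.shortRoots.Nonempty := hmax.1.1.of_image
  have : Nonempty ι := ⟨hs.some⟩
  rw [E.isMaximalRootSubsystem_lift_iff hP hmax]
  constructor
  · intro h
    refine Subset.antisymm ?_ (E.lacingNumber_smul_Λs_subset hP)
    obtain ⟨l, hl⟩ := P.exists_mem_longRoots
    have hsub : ∀ (n : ℤ) (y z : Y), y ∈ E.Λs → z ∈ E.Λs → y - n • z ∈ E.Λs := by
      intro n y z hy hz
      have hnat : ∀ (n : ℕ) (z : Y), z ∈ E.Λs → y - n • z ∈ E.Λs := by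
        intro n z hz
        induction n with
        | zero => simpa using hy
        | succ n ih =>
          have := E.add_mem_Λs_of_isMaximalRootSubsystem hP hB hmax ih (E.neg_mem_Λs hz)
          rw [succ_nsmul]
          convert this using 1
          abel
      obtain ⟨n, rfl | rfl⟩ := n.eq_nat_or_neg
      · simpa using hnat n z hz
      · simpa using hnat n (-z) (E.neg_mem_Λs hz)
    -- Test family: full short fibres, and mΛ_s over the long roots. It is closed because a long
    -- fibre is only shifted by multiples of m times elements of Λ_s, and Λ_s is a group.
    set Z : ι → Set Y := fun i =>
      {y | y ∈ E.Λ i ∧ (i ∈ P.longRoots → y ∈ P.lacingNumber • E.Λs)} with hZ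
    have hclosed : E.IsClosedSubfamily Z := by
      refine ⟨fun i y hy => hy.1, fun i j y hy z hz => ⟨E.sub_smul_mem i j y hy.1 z hz.1, ?_⟩⟩
      intro hj
      rw [hP.reflectionPerm_mem_longRoots_iff] at hj
      obtain ⟨y, hys, rfl⟩ := hy.2 hj
      by_cases hi : i ∈ P.longRoots
      · obtain ⟨z, hzs, rfl⟩ := hz.2 hi
        obtain ⟨n, hn⟩ := P.exists_value (S := ℤ) j i
        refine ⟨_, hsub n y z hys hzs, ?_⟩
        simp only [← hn, eq_intCast, Int.cast_smul_eq_zsmul, smul_sub]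
        rw [smul_comm]
      · rw [← RootPairing.mem_shortRoots_iff_notMem_longRoots] at hi
        have hzs := hz.1
        rw [← E.Λs_eq hP hi] at hzs
        by_cases h0 : P.pairing i j = 0
        · rw [P.pairing_eq_zero_iff'.1 h0, zero_smul, sub_zero]
          exact smul_mem_smul_set hys
        obtain ⟨ε, hε, -, h2⟩ := hP.pairing_short_long hi hj h0
        rw [h2, mul_comm, mul_smul, ← smul_sub]
        refine smul_mem_smul_set ?_
        rcases hε with rfl | rfl
        · simpa using hsub 1 y z hys hzs
        · simpa using hsub (-1) y z hys hzs
    have h0 : (0 : Y) ∈ E.Λs := by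
      rw [E.Λs_eq hP hs.some_mem]
      exact E.zero_mem_of_isReduced _
    intro y hy
    rw [E.Λl_eq hP hl] at hy
    refine (h Z hclosed ?_ ?_ l hy).2 hl
    · exact fun i hi y hy => ⟨hy, fun hi' =>
        absurd hi' (RootPairing.mem_shortRoots_iff_notMem_longRoots.1 hi)⟩
    · exact fun i => ⟨0, E.zero_mem_of_isReduced i, fun _ => ⟨0, h0, smul_zero _⟩⟩
  · intro h Z hZ hSZ hne j
    by_cases hj : j ∈ P.longRoots
    swap
    · exact hSZ j (RootPairing.mem_shortRoots_iff_notMem_longRoots.2 hj)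
    obtain ⟨i, hi, hij⟩ := hP.exists_shortRoot_pairing_ne_zero hs j
    obtain ⟨ε, hε, -, h2⟩ := hP.pairing_short_long hi hj hij
    -- Reflecting in i ⊕ εz and then in i ⊕ 0 returns to j and subtracts (εm)(εz) = mz.
    have htrans : ∀ y ∈ Z j, ∀ z ∈ E.Λs, y - P.lacingNumber • z ∈ Z j := by
      intro y hy z hz
      have hzi : ε • z ∈ Z i := by
        refine hSZ i hi ?_
        rw [← E.Λs_eq hP hi]
        rcases hε with rfl | rfl
        · rwa [one_smul]
        · rw [neg_one_smul]; exact E.neg_mem_Λs hz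
      have h3 := hZ.sub_smul_mem i _ _ (hZ.sub_smul_mem i j y hy _ hzi) 0
        (hSZ i hi (E.zero_mem_of_isReduced i))
      rw [P.reflectionPerm_self, smul_zero, sub_zero, h2, smul_smul] at h3
      convert h3 using 3
      rcases hε with rfl | rfl <;> ring
    obtain ⟨y, hy⟩ := hne j
    have hyl := hZ.subset j hy
    rw [← E.Λl_eq hP hj, h] at hyl
    obtain ⟨y, hys, rfl⟩ := hyl
    -- A point my of the fibre is moved to 0, and from there to every element of mΛ_s.
    have h0 := htrans _ hy y hys
    rw [sub_self] at h0
    intro x hx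
    rw [← E.Λl_eq hP hj, h] at hx
    obtain ⟨x, hxs, rfl⟩ := hx
    have := htrans _ h0 _ (E.neg_mem_Λs hxs)
    rwa [smul_neg, sub_neg_eq_add, zero_add] at this

/-- Maximality of the lift of the long roots. -/
theorem isMaximalRootSubsystem_lift_longRoots_iff (hP : P.IsEuclidean) (E : ExtensionDatum P Y)
    (hmax : IsMaximalRootSubsystem (innerₗ V) (range P.root) (P.root '' P.longRoots)) :
    IsMaximalRootSubsystem (E.affineReflectionSystem hP).form
      (E.affineReflectionSystem hP).realRoots (E.lift P.longRoots) ↔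
    (AddSubgroup.closure E.Λl : Set Y) = E.Λs := by
  obtain ⟨s, hs⟩ : P.shortRoots.Nonempty := by
    by_contra! h
    refine hmax.2.1 ?_
    rw [← image_univ]
    congr 1
    refine eq_univ_of_forall fun i => ?_
    by_contra hi
    rw [← RootPairing.mem_shortRoots_iff_notMem_longRoots, h] at hi
    exact hi
  rw [E.isMaximalRootSubsystem_lift_iff hP hmax]
  constructor
  · intro h
    refine Subset.antisymm (E.closure_Λl_subset hP ⟨s, hs⟩) ?_
    set C := AddSubgroup.closure E.Λl with hC
    set Z : ι → Set Y := fun i => {y | y ∈ E.Λ i ∧ (i ∈ P.shortRoots → y ∈ C)} with hZ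
    -- All fibres of the test family lie in the subgroup ⟨Λ_ℓ⟩, so integrality of the Cartan
    -- integers is enough for closure and no case split on lengths is needed.
    have hmem : ∀ i, ∀ y ∈ Z i, y ∈ C := by
      intro i y hy
      by_cases hi : i ∈ P.longRoots
      · refine AddSubgroup.subset_closure ?_
        rw [E.Λl_eq hP hi]
        exact hy.1
      · exact hy.2 (RootPairing.mem_shortRoots_iff_notMem_longRoots.2 hi)
    have hclosed : E.IsClosedSubfamily Z := by
      refine ⟨fun i y hy => hy.1, fun i j y hy z hz => ⟨E.sub_smul_mem i j y hy.1 z hz.1, ?_⟩⟩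
      intro _
      obtain ⟨n, hn⟩ := P.exists_value (S := ℤ) j i
      rw [← hn, eq_intCast, Int.cast_smul_eq_zsmul]
      exact C.sub_mem (hmem j y hy) (C.zsmul_mem (hmem i z hz) n)
    intro y hy
    rw [E.Λs_eq hP hs] at hy
    refine (h Z hclosed ?_ ?_ s hy).2 hs
    · exact fun i hi y hy => ⟨hy, fun hi' =>
        absurd hi (RootPairing.mem_shortRoots_iff_notMem_longRoots.1 hi')⟩
    · exact fun i => ⟨0, E.zero_mem_of_isReduced i, fun _ => C.zero_mem⟩
  · intro h Z hZ hSZ hne i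
    by_cases hi : i ∈ P.longRoots
    · exact hSZ i hi
    rw [← RootPairing.mem_shortRoots_iff_notMem_longRoots] at hi
    obtain ⟨j, hj, hji⟩ := hP.exists_longRoot_pairing_ne_zero i
    obtain ⟨ε, hε, h1, -⟩ := hP.pairing_short_long hi hj (mt P.pairing_eq_zero_iff'.1 hji)
    -- The same double reflection, now in j ⊕ −εz and j ⊕ 0 with (i, j^∨) = ε.
    have htrans : ∀ y ∈ Z i, ∀ z ∈ E.Λl, y + z ∈ Z i := by
      intro y hy z hz
      have hzj : -(ε • z) ∈ Z j := by
        refine hSZ j hj (E.neg_mem ?_)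
        rw [← E.Λl_eq hP hj]
        rcases hε with rfl | rfl
        · rwa [one_smul]
        · rw [neg_one_smul]; exact E.neg_mem_Λl hz
      have h3 := hZ.sub_smul_mem j _ _ (hZ.sub_smul_mem j i y hy _ hzj) 0
        (hSZ j hj (E.zero_mem_of_isReduced j))
      rw [P.reflectionPerm_self, smul_zero, sub_zero, h1, smul_neg, smul_smul,
        sub_neg_eq_add] at h3
      rcases hε with rfl | rfl <;> simpa using h3
    have htrans' : ∀ y ∈ Z i, ∀ z ∈ AddSubgroup.closure E.Λl, y + z ∈ Z i := by
      intro y hy z hz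
      induction hz using AddSubgroup.closure_induction_right with
      | zero => rwa [add_zero]
      | add_right x _ z hz hx => rw [← add_assoc]; exact htrans _ hx _ hz
      | add_neg_cancel x _ z hz hx =>
        rw [← add_assoc]; exact htrans _ hx _ (E.neg_mem_Λl hz)
    obtain ⟨y, hy⟩ := hne i
    have hyC : y ∈ AddSubgroup.closure E.Λl := by
      rw [← SetLike.mem_coe, h, E.Λs_eq hP hi]
      exact hZ.subset i hy
    intro x hx
    have hxC : x ∈ AddSubgroup.closure E.Λl := by
      rw [← SetLike.mem_coe, h, E.Λs_eq hP hi]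
      exact hx
    -- Both points lie in Λ_s = ⟨Λ_ℓ⟩, so their difference is an allowed translation.
    have := htrans' y hy _ (sub_mem hxC hyC)
    rwa [add_sub_cancel] at this

end ExtensionDatum

theorem mainTheorem8 {ι V N Y : Type*} [Finite ι]
    [NormedAddCommGroup V] [InnerProductSpace ℝ V] [FiniteDimensional ℝ V]
    [AddCommGroup N] [Module ℝ N]
    [AddCommGroup Y] [Module ℝ Y] [FiniteDimensional ℝ Y]
    (P : RootPairing ι ℝ V N) [P.IsRootSystem] [P.IsCrystallographic] [P.IsReduced]
    [P.IsIrreducible] (hP : P.IsEuclidean) (E : ExtensionDatum P Y) :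
    ((P.IsTypeB2 → ∃ G : AddSubgroup Y, (G : Set Y) = E.Λs) →
      IsMaximalRootSubsystem (innerₗ V) (range P.root) (P.root '' P.shortRoots) →
      (IsMaximalRootSubsystem (E.affineReflectionSystem hP).form
          (E.affineReflectionSystem hP).realRoots (E.lift P.shortRoots) ↔
        E.Λl = P.lacingNumber • E.Λs)) ∧
    (IsMaximalRootSubsystem (innerₗ V) (range P.root) (P.root '' P.longRoots) →
      (IsMaximalRootSubsystem (E.affineReflectionSystem hP).form
          (E.affineReflectionSystem hP).realRoots (E.lift P.longRoots) ↔
        (AddSubgroup.closure E.Λl : Set Y) = E.Λs)) := by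
  exact ⟨fun hB hmax => E.isMaximalRootSubsystem_lift_shortRoots_iff hP hB hmax,
    fun hmax => E.isMaximalRootSubsystem_lift_longRoots_iff hP hmax⟩
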